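/- Let $0\le a<b\le 1$. The Bernoulli channel restricted to inputs in $[a,b]$, denoted $B|_{[a,b]}$, outputs on input $x\in[a,b]$ the symbol $1$ with probability $x$ and the symbol $0$ with probability $1-x$; for an input word $u=(x_1,\dots,x_n)\in[a,b]^n$, $B^n(\cdot\mid u)$ denotes the product law on $\{0,1\}^n$ of the outputs of $n$ independent uses. For $\lambda_1,\lambda_2>0$, an $(n,N,\lambda_1,\lambda_2)$ deterministic identification (DI) code is a family $(u_i,\mathcal D_i)_{i=1}^N$ of words $u_i\in[a,b]^n$ and (possibly overlapping) regions $\mathcal D_i\subseteq\{0,1\}^n$ such that $B^n(\mathcal D_i\mid u_i)\ge 1-\lambda_1$ for every $i$ and $B^n(\mathcal D_j\mid u_i)\le\lambda_2$ for all $i\ne j$. A number $\dot R>0$ is an achievable linearithmic rate if there is a sequence of $(n,N^{(n)},\lambda_1^{(n)},\lambda_2^{(n)})$ DI codes with $\lambda_1^{(n)},\lambda_2^{(n)}\to0$ and $\frac{\log N^{(n)}}{n\log n}\to\dot R$ as $n\to\infty$; the codes of such a sequence are said to achieve the rate $\dot R$. The linearithmic DI capacity $\dot C_{\mathrm{DI}}(B|_{[a,b]})$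 is the largest achievable linearithmic rate. Theorem. Put $\lambda^{(n)}=2\exp\left[-2(\log n)^2\right]$ (natural logarithm). For every fixed integer $L\ge1$ there is a sequence of $(n,N^{(n)},L\lambda^{(n)},\lambda^{(n)})$ DI codes over $B|_{[a,b]}$ that achieves the linearithmic rate $\dot R=\frac12$. Moreover, the maximum defining the capacity exists, and \[ \dot C_{\mathrm{DI}}(B|_{[a,b]})=\tfrac12 . \] -/

import Mathlib

open MeasureTheory ProbabilityTheory Filter Topology

noncomputable section

namespace DetId

/-- The output law `W^n(· | u)` of `n` memoryless uses of the channel `W` on the input word `u`. -/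
def outputLaw {X Y : Type*} [MeasurableSpace X] [MeasurableSpace Y]
    (W : Kernel X Y) [IsMarkovKernel W] {n : ℕ} (u : Fin n → X) : Measure (Fin n → Y) :=
  Measure.pi fun t => W (u t)

/-- An `(n, N, lam₁, lam₂)` deterministic identification (DI) code over `n` uses of the
channel `W`: input words with decoding regions (which may overlap), with missed identification
probability at most `lam₁` and false identification probability at most `lam₂`. -/
structure DICode {X Y : Type*} [MeasurableSpace X] [MeasurableSpace Y]
    (W : Kernel X Y) [IsMarkovKernel W] (n N : ℕ) (lam₁ lam₂ : ℝ) where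
  word : Fin N → Fin n → X
  region : Fin N → Set (Fin n → Y)
  measurableSet_region : ∀ i, MeasurableSet (region i)
  pos₁ : 0 < lam₁
  pos₂ : 0 < lam₂
  missed_le : ∀ i, 1 - lam₁ ≤ (outputLaw W (word i)).real (region i)
  false_le : ∀ i j, i ≠ j → (outputLaw W (word i)).real (region j) ≤ lam₂

/-- There is a sequence of `(n, N n, lam₁ n, lam₂ n)` DI codes, reliable (both error bounds
vanish), whose rate `log N / (n log n)` tends to `R`. -/
def CodesAchieveRate {X Y : Type*} [MeasurableSpace X] [MeasurableSpace Y]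
    (W : Kernel X Y) [IsMarkovKernel W] (N : ℕ → ℕ) (lam₁ lam₂ : ℕ → ℝ) (R : ℝ) : Prop :=
  (∀ n, Nonempty (DICode W n (N n) (lam₁ n) (lam₂ n))) ∧
    Tendsto lam₁ atTop (𝓝 0) ∧ Tendsto lam₂ atTop (𝓝 0) ∧
    Tendsto (fun n : ℕ => Real.log (N n) / (n * Real.log n)) atTop (𝓝 R)

/-- `R > 0` is an achievable linearithmic DI rate of `W`. -/
def IsAchievableRate {X Y : Type*} [MeasurableSpace X] [MeasurableSpace Y]
    (W : Kernel X Y) [IsMarkovKernel W] (R : ℝ) : Prop :=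
  0 < R ∧ ∃ (N : ℕ → ℕ) (lam₁ lam₂ : ℕ → ℝ), CodesAchieveRate W N lam₁ lam₂ R

/-- `C` is the linearithmic DI capacity of `W`, i.e. its largest achievable linearithmic rate. -/
def IsLinearithmicDICapacity {X Y : Type*} [MeasurableSpace X] [MeasurableSpace Y]
    (W : Kernel X Y) [IsMarkovKernel W] (C : ℝ) : Prop :=
  IsGreatest {R : ℝ | IsAchievableRate W R} C

/-- The Bernoulli channel: on input `x ∈ [0,1]` the output is `true` (the symbol `1`) with
probability `x` and `false` (the symbol `0`) with probability `1 - x`. -/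
def bernoulliChannel : Kernel unitInterval Bool where
  toFun x := bernoulliMeasure true false x
  measurable' := by
    refine Measure.measurable_of_measurable_coe _ fun s hs => ?_
    classical
    simp_rw [bernoulliMeasure_apply _ hs]
    have h1 : Measurable fun x : unitInterval => (unitInterval.toNNReal x : ENNReal) :=
      (ENNReal.continuous_coe.comp unitInterval.toNNReal_continuous).measurable
    have h2 : Measurable fun x : unitInterval =>
        (unitInterval.toNNReal (unitInterval.symm x) : ENNReal) :=
      h1.comp unitInterval.continuous_symm.measurable
    split_ifs <;> first | exact measurable_const | exact h1 | exact h2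

instance : IsMarkovKernel bernoulliChannel where
  isProbabilityMeasure x :=
    inferInstanceAs (IsProbabilityMeasure (bernoulliMeasure true false x))

/-- The channel `W` with its inputs restricted to the set `S`. -/
def restrictInput {X Y : Type*} [MeasurableSpace X] [MeasurableSpace Y]
    (W : Kernel X Y) (S : Set X) : Kernel S Y :=
  W.comap Subtype.val measurable_subtype_coe

instance {X Y : Type*} [MeasurableSpace X] [MeasurableSpace Y]
    (W : Kernel X Y) [IsMarkovKernel W] (S : Set X) : IsMarkovKernel (restrictInput W S) :=
  inferInstanceAs (IsMarkovKernel (W.comap Subtype.val measurable_subtype_coe))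

/-- The error bound `lam = 2 exp(-2 (log n)^2)`. -/
def errorBound (n : ℕ) : ℝ := 2 * Real.exp (-2 * Real.log n ^ 2)

end DetId

end

/-! Converse: put x = sin² θ. The Bhattacharyya coefficient of the output laws of two words is then
the product of the cosines of their angle differences (`sum_sqrt_outputLaw`). Reliability forces
this coefficient to be at most `√lam₁ + √lam₂` (`prod_cos_le_of_diCode`), while words in the same
cell of a grid of side 1/√n in the angles have coefficient at least 1/2. So words occupy distinct
cells, and (3√n)^n cells give rate at most 1/2.

Achievability: a word is identified by checking that `L` weighted counts of ones are close to their
means. By Hoeffding these deviate by about √n log n, so it suffices that one of the tests of each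
word shifts by twice that under any other word. Words are superpositions of `L` integer layers,
layer `m` scaled by M^{-m}, and test `l` weights by layer `l`. Pigeonholing makes all inner products
between layers the same for every word, at polynomial cost. In the first layer `l` where x and y
differ, equal norms give ⟨x_l, y_l - x_l⟩ = -D/2 with D = |y_l - x_l|². Earlier layers cancel. For
later ones, equal inner products turn ⟨x_l, y_m - x_m⟩ into -⟨y_l - x_l, y_m⟩, at most qD in
absolute value, which M = 4Lq damps (`exists_separating_component`). A Gilbert–Varshamov code in
each layer makes D of order n. With q about n^{1/(2(L+3))} the rate tends to (L-1)/(2(L+3)), which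
approaches 1/2 as `L` grows. -/

noncomputable section

namespace DetId

/-! ### Hoeffding bounds and decoding by linear tests -/

/-- The numerical value of an output symbol. -/
def bit (y : Bool) : ℝ := if y then 1 else 0

instance {X Y : Type*} [MeasurableSpace X] [MeasurableSpace Y]
    (W : Kernel X Y) [IsMarkovKernel W] {n : ℕ} (u : Fin n → X) :
    IsProbabilityMeasure (outputLaw W u) :=
  inferInstanceAs (IsProbabilityMeasure (Measure.pi fun t => W (u t)))

lemma restrictInput_bernoulliChannel_apply {S : Set unitInterval} (x : S) :
    restrictInput bernoulliChannel S x = bernoulliMeasure true false x := rfl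

/-- Hoeffding's lemma on an interval of length 1 gives the parameter (1/2)²; a weight of modulus at
most 1 does not increase it. -/
lemma hasSubgaussianMGF_outputLaw {S : Set unitInterval} {n : ℕ} (u : Fin n → S)
    (c : Fin n → ℝ) (hc : ∀ t, |c t| ≤ 1) (t : Fin n) :
    HasSubgaussianMGF (fun y : Fin n → Bool => c t * (bit (y t) - (u t : unitInterval)))
      (1 / 4) (outputLaw (restrictInput bernoulliChannel S) u) := by
  have hcoord : HasSubgaussianMGF (fun y : Bool => bit y - (u t : unitInterval)) (1 / 4)
      (restrictInput bernoulliChannel S (u t)) := by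
    have h := hasSubgaussianMGF_of_mem_Icc (μ := restrictInput bernoulliChannel S (u t))
      (X := bit) (a := 0) (b := 1) (measurable_of_finite _).aemeasurable
      (ae_of_all _ fun y => by cases y <;> simp [bit])
    have hm : ∫ y, bit y ∂(restrictInput bernoulliChannel S (u t)) = (u t : unitInterval) := by
      rw [restrictInput_bernoulliChannel_apply, integral_bernoulliMeasure]
      simp [bit]
    rw [hm] at h
    convert h using 1
    ext
    norm_num
  have h2 : HasSubgaussianMGF (fun y : Bool => c t * (bit y - (u t : unitInterval))) (1 / 4)
      (restrictInput bernoulliChannel S (u t)) := by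
    have hmul := hcoord.const_mul (c t)
    have hsq : c t ^ 2 ≤ 1 := by
      rw [← sq_abs]; exact pow_le_one₀ (abs_nonneg _) (hc t)
    refine ⟨hmul.integrable_exp_mul, fun s => (hmul.mgf_le s).trans (Real.exp_le_exp.2 ?_)⟩
    change c t ^ 2 * ((1 / 4 : NNReal) : ℝ) * s ^ 2 / 2 ≤ _
    push_cast
    nlinarith [mul_le_mul_of_nonneg_right hsq (sq_nonneg s)]
  have hmap : (outputLaw (restrictInput bernoulliChannel S) u).map (fun y => y t) =
      restrictInput bernoulliChannel S (u t) :=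
    (measurePreserving_eval (fun t => restrictInput bernoulliChannel S (u t)) t).map_eq
  rw [← hmap] at h2
  exact HasSubgaussianMGF.of_map (Y := fun y : Fin n → Bool => y t)
    (X := fun y => c t * (bit y - (u t : unitInterval))) (measurable_pi_apply t).aemeasurable h2

/-- Hoeffding's bound for a weighted count of the ones in the channel output. -/
lemma outputLaw_real_le_abs_sum {S : Set unitInterval} {n : ℕ} (u : Fin n → S)
    (c : Fin n → ℝ) (hc : ∀ t, |c t| ≤ 1) {τ : ℝ} (hτ : 0 ≤ τ) :
    (outputLaw (restrictInput bernoulliChannel S) u).real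
      {y | τ ≤ |∑ t, c t * (bit (y t) - (u t : unitInterval))|} ≤
      2 * Real.exp (-2 * τ ^ 2 / n) := by
  have key : ∀ c : Fin n → ℝ, (∀ t, |c t| ≤ 1) →
      (outputLaw (restrictInput bernoulliChannel S) u).real
        {y | τ ≤ ∑ t, c t * (bit (y t) - (u t : unitInterval))} ≤
        Real.exp (-2 * τ ^ 2 / n) := by
    intro c hc
    have hind : iIndepFun (fun t (y : Fin n → Bool) => c t * (bit (y t) - (u t : unitInterval)))
        (outputLaw (restrictInput bernoulliChannel S) u) :=
      iIndepFun_pi (X := fun t y => c t * (bit y - (u t : unitInterval)))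
        fun t => (measurable_of_finite _).aemeasurable
    have h := HasSubgaussianMGF.measure_sum_ge_le_of_iIndepFun hind (s := Finset.univ)
      (fun t _ => hasSubgaussianMGF_outputLaw u c hc t) hτ
    refine h.trans (Real.exp_le_exp.2 (le_of_eq ?_))
    rcases Nat.eq_zero_or_pos n with rfl | hn
    · simp
    · have : (0 : ℝ) < n := by exact_mod_cast hn
      push_cast
      simp only [Finset.sum_const, Finset.card_univ, Fintype.card_fin, nsmul_eq_mul]
      field_simp
      norm_num
  have h1 := key c hc
  have h2 := key (fun t => -c t) (fun t => by rw [abs_neg]; exact hc t)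
  refine (measureReal_mono (s₂ := {y | τ ≤ ∑ t, c t * (bit (y t) - (u t : unitInterval))} ∪
    {y | τ ≤ ∑ t, -c t * (bit (y t) - (u t : unitInterval))}) ?_).trans
    ((measureReal_union_le _ _).trans (by linarith))
  intro y hy
  change τ ≤ _ ∨ τ ≤ _
  simp only [neg_mul, Finset.sum_neg_distrib]
  exact le_abs.1 hy

/-- A family of words in which any two words are separated by one of `L` linear tests
attached to the first word is a DI code. -/
lemma nonempty_diCode_of_separated {S : Set unitInterval} {n N L : ℕ} {ι : Type*} [Fintype ι]
    (hN : N ≤ Fintype.card ι) (u : ι → Fin n → S) (c : ι → Fin L → Fin n → ℝ)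
    (hc : ∀ i l t, |c i l t| ≤ 1) {τ lam₁ lam₂ : ℝ} (hτ : 0 ≤ τ)
    (hsep : ∀ i j, i ≠ j → ∃ l, 2 * τ ≤
      |∑ t, c i l t * (((u j t : unitInterval) : ℝ) - (u i t : unitInterval))|)
    (h₁ : L * (2 * Real.exp (-2 * τ ^ 2 / n)) ≤ lam₁)
    (h₂ : 2 * Real.exp (-2 * τ ^ 2 / n) ≤ lam₂) (pos₁ : 0 < lam₁) :
    Nonempty (DICode (restrictInput bernoulliChannel S) n N lam₁ lam₂) := by
  obtain ⟨f⟩ : Nonempty (Fin N ↪ ι) :=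
    Function.Embedding.nonempty_of_card_le (by simpa using hN)
  refine ⟨⟨fun i => u (f i), fun i => {y | ∀ l,
    |∑ t, c (f i) l t * (bit (y t) - (u (f i) t : unitInterval))| < τ},
    fun i => (Set.toFinite _).measurableSet, pos₁, lt_of_lt_of_le (by positivity) h₂,
    fun i => ?_, fun i j hij => ?_⟩⟩
  · set P := outputLaw (restrictInput bernoulliChannel S) (u (f i))
    have hcompl : P.real {y | ∀ l,
        |∑ t, c (f i) l t * (bit (y t) - (u (f i) t : unitInterval))| < τ}ᶜ ≤ lam₁ := by
      have : {y : Fin n → Bool | ∀ l,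
          |∑ t, c (f i) l t * (bit (y t) - (u (f i) t : unitInterval))| < τ}ᶜ =
          ⋃ l, {y | τ ≤ |∑ t, c (f i) l t * (bit (y t) - (u (f i) t : unitInterval))|} := by
        ext y; simp
      rw [this]
      refine (measureReal_iUnion_fintype_le _).trans (le_trans ?_ h₁)
      refine (Finset.sum_le_sum fun l _ =>
        outputLaw_real_le_abs_sum (u (f i)) (c (f i) l) (hc _ l) hτ).trans ?_
      simp
    rw [probReal_compl_eq_one_sub (Set.toFinite _).measurableSet] at hcompl
    linarith
  -- The test belongs to the owner of the region. Its mean shifts by at least 2τ, so an output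
  -- within τ of the owner's mean is at least τ away from the mean under the transmitted word.
  · obtain ⟨l, hl⟩ := hsep (f j) (f i) (fun h => hij (f.injective h).symm)
    refine le_trans (measureReal_mono ?_)
      ((outputLaw_real_le_abs_sum (u (f i)) (c (f j) l) (hc _ l) hτ).trans h₂)
    intro y hy
    have hy := hy l
    have hsplit : ∑ t, c (f j) l t * (bit (y t) - (u (f j) t : unitInterval)) =
        ∑ t, c (f j) l t * (bit (y t) - (u (f i) t : unitInterval)) +
        ∑ t, c (f j) l t * (((u (f i) t : unitInterval) : ℝ) - (u (f j) t : unitInterval)) := by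
      rw [← Finset.sum_add_distrib]
      exact Finset.sum_congr rfl fun t _ => by ring
    rw [hsplit] at hy
    change τ ≤ _
    have := abs_sub_abs_le_abs_add
      (∑ t, c (f j) l t * (((u (f i) t : unitInterval) : ℝ) - (u (f j) t : unitInterval)))
      (∑ t, c (f j) l t * (bit (y t) - (u (f i) t : unitInterval)))
    rw [add_comm] at hy
    linarith

/-! ### Converse via the Bhattacharyya coefficient -/

/-- The Bhattacharyya coefficient of two subprobability vectors is small if some set has large
mass under the first and small mass under the second. -/
lemma sum_sqrt_mul_le {α : Type*} [Fintype α] (p q : α → ℝ)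
    (hp : ∀ x, 0 ≤ p x) (hq : ∀ x, 0 ≤ q x) (hp1 : ∑ x, p x ≤ 1) (hq1 : ∑ x, q x ≤ 1)
    (D : Finset α) {s t : ℝ} (hs : ∑ x, p x - ∑ x ∈ D, p x ≤ s) (ht : ∑ x ∈ D, q x ≤ t) :
    ∑ x, √(p x * q x) ≤ √s + √t := by
  classical
  have cs : ∀ E : Finset α, ∑ x ∈ E, √(p x * q x) ≤ √(∑ x ∈ E, p x) * √(∑ x ∈ E, q x) := by
    intro E
    simp_rw [fun x => Real.sqrt_mul (hp x) (q x)]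
    exact Real.sum_sqrt_mul_sqrt_le E hp hq
  have hle : ∀ (r : α → ℝ), (∀ x, 0 ≤ r x) → ∑ x, r x ≤ 1 → ∀ E : Finset α,
      √(∑ x ∈ E, r x) ≤ 1 := fun r hr h1 E => by
    rw [← Real.sqrt_one]
    exact Real.sqrt_le_sqrt
      ((Finset.sum_le_univ_sum_of_nonneg hr).trans h1)
  -- Cauchy–Schwarz separately off `D`, where `p` has small mass, and on `D`, where `q` has.
  rw [← Finset.sum_add_sum_compl D, add_comm]
  refine add_le_add ((cs _).trans ?_) ((cs _).trans ?_)
  · refine (mul_le_of_le_one_right (Real.sqrt_nonneg _) (hle q hq hq1 _)).trans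
      (Real.sqrt_le_sqrt ?_)
    have := Finset.sum_add_sum_compl D p
    linarith
  · exact (mul_le_of_le_one_left (Real.sqrt_nonneg _) (hle p hp hp1 _)).trans
      (Real.sqrt_le_sqrt ht)

/-- The angle whose squared sine is the input letter. -/
def angle (x : unitInterval) : ℝ := Real.arcsin √(x : ℝ)

lemma angle_nonneg (x : unitInterval) : 0 ≤ angle x :=
  Real.arcsin_nonneg.2 (Real.sqrt_nonneg _)

lemma angle_le_two (x : unitInterval) : angle x ≤ 2 :=
  (Real.arcsin_le_pi_div_two _).trans (by linarith [Real.pi_le_four])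

lemma sin_angle (x : unitInterval) : Real.sin (angle x) = √(x : ℝ) :=
  Real.sin_arcsin ((by norm_num : (-1 : ℝ) ≤ 0).trans (Real.sqrt_nonneg _))
    (Real.sqrt_le_one.2 x.2.2)

lemma cos_angle (x : unitInterval) : Real.cos (angle x) = √(1 - (x : ℝ)) := by
  rw [angle, Real.cos_arcsin, Real.sq_sqrt x.2.1]

/-- The probability of the output `y` on the input `x`. -/
def letterProb (x : unitInterval) (y : Bool) : ℝ := if y then x else 1 - x

lemma letterProb_nonneg (x : unitInterval) (y : Bool) : 0 ≤ letterProb x y := by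
  unfold letterProb; split_ifs
  · exact x.2.1
  · linarith [x.2.2]

lemma sum_sqrt_letterProb_mul (x x' : unitInterval) :
    ∑ y, √(letterProb x y * letterProb x' y) = Real.cos (angle x - angle x') := by
  rw [Real.cos_sub, sin_angle, sin_angle, cos_angle, cos_angle]
  simp only [Fintype.sum_bool, letterProb, if_true, Bool.false_eq_true, if_false]
  rw [Real.sqrt_mul x.2.1, Real.sqrt_mul (by linarith [x.2.2]), add_comm]

lemma outputLaw_real_singleton {S : Set unitInterval} {n : ℕ} (u : Fin n → S) (y : Fin n → Bool) :
    (outputLaw (restrictInput bernoulliChannel S) u).real {y} = ∏ t, letterProb (u t) (y t) := by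
  rw [outputLaw, measureReal_def, Measure.pi_singleton, ENNReal.toReal_prod]
  refine Finset.prod_congr rfl fun t _ => ?_
  change (bernoulliMeasure true false (u t : unitInterval)).real {y t} = _
  cases y t <;> simp [letterProb]

/-- The coefficient is multiplicative over product laws, and each letter contributes the cosine
addition formula. -/
lemma sum_sqrt_outputLaw {S : Set unitInterval} {n : ℕ} (u v : Fin n → S) :
    ∑ y, √((outputLaw (restrictInput bernoulliChannel S) u).real {y} *
      (outputLaw (restrictInput bernoulliChannel S) v).real {y}) =
      ∏ t, Real.cos (angle (u t) - angle (v t)) := by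
  simp_rw [outputLaw_real_singleton, ← Finset.prod_mul_distrib, ← sum_sqrt_letterProb_mul]
  rw [Finset.prod_univ_sum, Fintype.piFinset_univ]
  refine Finset.sum_congr rfl fun y _ => ?_
  rw [Real.sqrt_eq_rpow, ← Real.finsetProd_rpow]
  · simp_rw [Real.sqrt_eq_rpow]
  · exact fun t _ => mul_nonneg (letterProb_nonneg _ _) (letterProb_nonneg _ _)

lemma prod_cos_le_of_diCode {S : Set unitInterval} {n N : ℕ} {lam₁ lam₂ : ℝ}
    (C : DICode (restrictInput bernoulliChannel S) n N lam₁ lam₂) {i j : Fin N} (hij : i ≠ j) :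
    ∏ t, Real.cos (angle (C.word i t) - angle (C.word j t)) ≤ √lam₁ + √lam₂ := by
  classical
  have hone : ∀ u : Fin n → S, ∑ y, (outputLaw (restrictInput bernoulliChannel S) u).real {y} = 1 :=
    fun u => by
      rw [sum_measureReal_singleton, Finset.coe_univ, probReal_univ]
  rw [← sum_sqrt_outputLaw]
  refine sum_sqrt_mul_le _ _ (fun _ => measureReal_nonneg) (fun _ => measureReal_nonneg)
    (hone _).le (hone _).le (C.region i).toFinite.toFinset ?_ ?_
  · rw [hone, sum_measureReal_singleton, Set.Finite.coe_toFinset]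
    linarith [C.missed_le i]
  · rw [sum_measureReal_singleton, Set.Finite.coe_toFinset]
    exact C.false_le j i hij.symm

/-- Each cosine is at least 1 - 1/(2n), and Bernoulli's inequality bounds the n-th power of that. -/
lemma half_le_prod_cos {n : ℕ} (d : Fin n → ℝ) (hd : ∀ t, d t ^ 2 * n ≤ 1) :
    1 / 2 ≤ ∏ t, Real.cos (d t) := by
  rcases Nat.eq_zero_or_pos n with rfl | hn
  · norm_num
  have hn' : (1 : ℝ) ≤ n := by exact_mod_cast hn
  have hinv : (n : ℝ)⁻¹ ≤ 1 := inv_le_one_of_one_le₀ hn'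
  have hcos : ∀ t, 1 + -(1 / (2 * n) : ℝ) ≤ Real.cos (d t) := fun t => by
    have h1 := Real.one_sub_sq_div_two_le_cos (x := d t)
    have h2 : d t ^ 2 ≤ 1 / n := (le_div_iff₀ (by linarith)).2 (hd t)
    have h3 : (1 / (2 * n) : ℝ) = 1 / n / 2 := by field_simp
    linarith
  have h3 : (1 / (2 * n) : ℝ) = (n : ℝ)⁻¹ / 2 := by field_simp
  have hB := one_add_mul_le_pow (a := -(1 / (2 * n) : ℝ)) (by linarith) n
  calc (1 / 2 : ℝ) = 1 + n * -(1 / (2 * n)) := by field_simp; norm_num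
    _ ≤ _ := hB
    _ = ∏ _t : Fin n, (1 + -(1 / (2 * n) : ℝ)) := by simp
    _ ≤ _ := Finset.prod_le_prod (fun t _ => by linarith) fun t _ => hcos t

/-- The size of a DI code with small errors is at most `(2√n + 1)^n`. -/
lemma diCode_card_le {S : Set unitInterval} {n N : ℕ} {lam₁ lam₂ : ℝ}
    (C : DICode (restrictInput bernoulliChannel S) n N lam₁ lam₂) (h : √lam₁ + √lam₂ < 1 / 2) :
    N ≤ (⌊2 * √n⌋₊ + 1) ^ n := by
  let cell : Fin N → Fin n → Fin (⌊2 * √n⌋₊ + 1) := fun i t =>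
    ⟨⌊angle (C.word i t) * √n⌋₊, Nat.lt_succ_of_le (Nat.floor_le_floor
      (mul_le_mul_of_nonneg_right (angle_le_two _) (Real.sqrt_nonneg _)))⟩
  have hinj : Function.Injective cell := by
    intro i j hij
    by_contra hne
    refine absurd (prod_cos_le_of_diCode C hne) (not_le.2 (h.trans_le (half_le_prod_cos _ ?_)))
    intro t
    have hf : ⌊angle (C.word i t) * √n⌋₊ = ⌊angle (C.word j t) * √n⌋₊ :=
      congrArg Fin.val (congrFun hij t)
    have hnn : ∀ k, 0 ≤ angle (C.word k t) * √n := fun k =>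
      mul_nonneg (angle_nonneg _) (Real.sqrt_nonneg _)
    have h1 := Nat.floor_le (hnn i)
    have h2 := Nat.floor_le (hnn j)
    have h3 := Nat.lt_floor_add_one (angle (C.word i t) * √n)
    have h4 := Nat.lt_floor_add_one (angle (C.word j t) * √n)
    rw [hf] at h1 h3
    have habs : |(angle (C.word i t) - angle (C.word j t)) * √n| ≤ 1 := by
      rw [sub_mul, abs_le]; constructor <;> linarith
    calc _ = ((angle (C.word i t) - angle (C.word j t)) * √n) ^ 2 := by
          rw [mul_pow, Real.sq_sqrt (Nat.cast_nonneg _)]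
      _ ≤ 1 := by rw [← sq_abs]; exact pow_le_one₀ (abs_nonneg _) habs
  simpa using Fintype.card_le_of_injective cell hinj

lemma rate_le_half {S : Set unitInterval} {N : ℕ → ℕ} {lam₁ lam₂ : ℕ → ℝ} {R : ℝ}
    (h : CodesAchieveRate (restrictInput bernoulliChannel S) N lam₁ lam₂ R) : R ≤ 1 / 2 := by
  obtain ⟨hC, h1, h2, hR⟩ := h
  have hlim : Tendsto (fun n => √(lam₁ n) + √(lam₂ n)) atTop (𝓝 0) := by
    simpa using (Real.continuous_sqrt.tendsto 0 |>.comp h1).add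
      (Real.continuous_sqrt.tendsto 0 |>.comp h2)
  have hlog : Tendsto (fun n : ℕ => Real.log n) atTop atTop :=
    Real.tendsto_log_atTop.comp tendsto_natCast_atTop_atTop
  have hup : Tendsto (fun n : ℕ => Real.log 3 / Real.log n + 1 / 2) atTop (𝓝 (1 / 2)) := by
    simpa only [zero_add] using (hlog.const_div_atTop (Real.log 3)).add_const (1 / 2)
  refine le_of_tendsto_of_tendsto hR hup ?_
  filter_upwards [hlim.eventually (gt_mem_nhds (by norm_num : (0 : ℝ) < 1 / 2)),
    eventually_ge_atTop 2] with n hn hn2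
  obtain ⟨C⟩ := hC n
  have hcard := diCode_card_le C hn
  have hn' : (2 : ℝ) ≤ n := by exact_mod_cast hn2
  have hs : (1 : ℝ) ≤ √n := Real.one_le_sqrt.2 (by linarith)
  have hlogn : 0 < Real.log n := Real.log_pos (by linarith)
  have hN : (N n : ℝ) ≤ (3 * √n) ^ n := by
    calc (N n : ℝ) ≤ ((⌊2 * √n⌋₊ : ℝ) + 1) ^ n := by exact_mod_cast hcard
      _ ≤ (3 * √n) ^ n := by
        gcongr
        have := Nat.floor_le (by positivity : 0 ≤ 2 * √(n : ℝ))
        linarith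
  have hlogN : Real.log (N n) ≤ n * (Real.log 3 + Real.log n / 2) := by
    -- An empty code has `Real.log 0 = 0`.
    rcases Nat.eq_zero_or_pos (N n) with h0 | h0
    · rw [h0]; simp only [Nat.cast_zero, Real.log_zero]
      have := Real.log_pos (by norm_num : (1 : ℝ) < 3)
      positivity
    · refine (Real.log_le_log (by exact_mod_cast h0) hN).trans (le_of_eq ?_)
      rw [Real.log_pow, Real.log_mul (by norm_num) (by positivity), Real.log_sqrt (by linarith)]
  rw [div_le_iff₀ (by positivity)]
  refine hlogN.trans (le_of_eq ?_)
  field_simp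

/-! ### Codes of integer words with prescribed inner products -/

/-- A crude bound for the size of a Hamming ball. -/
lemma card_hammingBall_le {n q d : ℕ} (hq : 1 ≤ q) (x : Fin n → Fin q) :
    (Finset.univ.filter fun y : Fin n → Fin q => hammingDist x y < d).card ≤ 2 ^ n * q ^ d := by
  classical
  -- Sort words by a set `A` of fewer than `d` positions outside which they agree with `x`: at most
  -- 2^n sets, each with at most q^d words.
  have hsub : (Finset.univ.filter fun y : Fin n → Fin q => hammingDist x y < d) ⊆
      (Finset.univ.filter fun A : Finset (Fin n) => A.card < d).biUnion
        fun A => Finset.univ.filter fun y : Fin n → Fin q => ∀ t, t ∉ A → y t = x t := by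
    intro y hy
    simp only [Finset.mem_filter, Finset.mem_univ, true_and, Finset.mem_biUnion] at hy ⊢
    refine ⟨Finset.univ.filter fun t => x t ≠ y t, hy, fun t ht => ?_⟩
    simpa [eq_comm] using ht
  refine (Finset.card_le_card hsub).trans (Finset.card_biUnion_le.trans ?_)
  calc _ ≤ ∑ A ∈ (Finset.univ.filter fun A : Finset (Fin n) => A.card < d), q ^ d := by
        refine Finset.sum_le_sum fun A hA => ?_
        have hA : A.card < d := by simpa using hA
        refine le_trans ?_ (Nat.pow_le_pow_right hq hA.le)
        have : q ^ A.card = (Finset.univ : Finset (A → Fin q)).card := by simp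
        rw [this]
        refine Finset.card_le_card_of_injOn (fun y (t : A) => y t) (by simp) ?_
        intro y hy z hz hyz
        simp only [Finset.coe_filter, Finset.mem_univ, true_and, Set.mem_ofPred_eq] at hy hz
        funext t
        by_cases ht : t ∈ A
        · exact congrFun hyz ⟨t, ht⟩
        · rw [hy t ht, hz t ht]
    _ ≤ 2 ^ n * q ^ d := by
        rw [Finset.sum_const, smul_eq_mul]
        refine Nat.mul_le_mul_right _ ((Finset.card_le_univ _).trans (by simp))

/-- The Gilbert–Varshamov bound. -/
lemma exists_hammingCode {n q : ℕ} (d : ℕ) (hq : 1 ≤ q) :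
    ∃ C : Finset (Fin n → Fin q), (∀ x ∈ C, ∀ y ∈ C, x ≠ y → d ≤ hammingDist x y) ∧
      q ^ n ≤ C.card * (2 ^ n * q ^ d) := by
  classical
  obtain ⟨C, hC⟩ := (Set.toFinite {C : Finset (Fin n → Fin q) |
    ∀ x ∈ C, ∀ y ∈ C, x ≠ y → d ≤ hammingDist x y}).exists_maximal ⟨∅, by simp⟩
  refine ⟨C, hC.prop, ?_⟩
  -- The disjunct `x = y` matters for `d = 0`, when the open ball misses its centre.
  have hcover : (Finset.univ : Finset (Fin n → Fin q)) ⊆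
      C.biUnion fun x => Finset.univ.filter fun y => x = y ∨ hammingDist x y < d := by
    intro y _
    by_contra hy
    simp only [Finset.mem_biUnion, Finset.mem_filter, Finset.mem_univ, true_and, not_exists,
      not_and, not_or, not_lt] at hy
    have hins : insert y C ∈ {C : Finset (Fin n → Fin q) |
        ∀ x ∈ C, ∀ y ∈ C, x ≠ y → d ≤ hammingDist x y} := by
      intro a ha b hb hab
      rcases Finset.mem_insert.1 ha with rfl | ha' <;>
        rcases Finset.mem_insert.1 hb with rfl | hb'
      · exact absurd rfl hab
      · rw [hammingDist_comm]; exact (hy b hb').2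
      · exact (hy a ha').2
      · exact hC.prop a ha' b hb' hab
    have hmem : y ∈ C := hC.le_of_ge hins (Finset.subset_insert y C) (Finset.mem_insert_self y C)
    exact (hy y hmem).1 rfl
  have hball : ∀ x : Fin n → Fin q,
      (Finset.univ.filter fun y => x = y ∨ hammingDist x y < d).card ≤ 2 ^ n * q ^ d := by
    intro x
    rcases Nat.eq_zero_or_pos d with rfl | hd
    · have : (Finset.univ.filter fun y => x = y ∨ hammingDist x y < 0) = {x} := by
        ext y; simp [eq_comm]
      rw [this]
      simpa using Nat.one_le_two_pow
    · refine le_trans (Finset.card_le_card fun y hy => ?_) (card_hammingBall_le hq x)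
      simp only [Finset.mem_filter, Finset.mem_univ, true_and] at hy ⊢
      rcases hy with rfl | hy
      · simpa using hd
      · exact hy
  have := (Finset.card_le_card hcover).trans
    (Finset.card_biUnion_le.trans (Finset.sum_le_card_nsmul _ _ _ fun x _ => hball x))
  simpa using this

/-- A large set of `L`-tuples of integer words in which distinct components are far apart in
Hamming distance and all inner products of components take a constant value. -/
lemma exists_equiangular_tuples (L n d : ℕ) {q : ℕ} (hq : 1 ≤ q) :
    ∃ T : Finset (Fin L → Fin n → Fin q),
      (∀ x ∈ T, ∀ y ∈ T, ∀ l, x l ≠ y l → d ≤ hammingDist (x l) (y l)) ∧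
      (∀ x ∈ T, ∀ y ∈ T, ∀ l m, ∑ t, (x l t : ℕ) * (x m t : ℕ) = ∑ t, (y l t : ℕ) * (y m t : ℕ)) ∧
      (q ^ n) ^ L ≤ (n * q ^ 2 + 1) ^ (L * L) * T.card * (2 ^ n * q ^ d) ^ L ∧ T.Nonempty := by
  classical
  obtain ⟨C, hC, hcard⟩ := exists_hammingCode (n := n) d hq
  have hCne : C.Nonempty := by
    rw [Finset.nonempty_iff_ne_empty]
    rintro rfl
    have : 0 < q ^ n := Nat.pow_pos hq
    simp at hcard
    omega
  let P : Finset (Fin L → Fin n → Fin q) := Fintype.piFinset fun _ => C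
  let key : (Fin L → Fin n → Fin q) → Fin L × Fin L → ℕ := fun x p =>
    ∑ t, (x p.1 t : ℕ) * (x p.2 t : ℕ)
  let K : Finset (Fin L × Fin L → ℕ) := Fintype.piFinset fun _ => Finset.range (n * q ^ 2 + 1)
  have hkey : ∀ x ∈ P, key x ∈ K := by
    intro x _
    rw [Fintype.mem_piFinset]
    intro p
    rw [Finset.mem_range, Nat.lt_succ_iff]
    calc _ ≤ ∑ _t : Fin n, q ^ 2 := Finset.sum_le_sum fun t _ => by
          rw [sq]; exact Nat.mul_le_mul (x p.1 t).2.le (x p.2 t).2.le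
      _ = n * q ^ 2 := by simp
  have hPne : P.Nonempty := Fintype.piFinset_nonempty.2 fun _ => hCne
  -- Pigeonhole: keep the most popular table of inner products.
  obtain ⟨k, -, hk⟩ := Finset.exists_max_image K (fun k => (P.filter fun x => key x = k).card)
    ⟨_, hkey _ hPne.choose_spec⟩
  have hle : P.card ≤ K.card * (P.filter fun x => key x = k).card := by
    rw [Finset.card_eq_sum_card_fiberwise hkey, ← smul_eq_mul]
    exact Finset.sum_le_card_nsmul _ _ _ hk
  refine ⟨P.filter fun x => key x = k, ?_, ?_, ?_, ?_⟩
  · intro x hx y hy l hl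
    exact hC _ (Fintype.mem_piFinset.1 (Finset.mem_filter.1 hx).1 l) _
      (Fintype.mem_piFinset.1 (Finset.mem_filter.1 hy).1 l) hl
  · intro x hx y hy l m
    exact congrFun ((Finset.mem_filter.1 hx).2.trans (Finset.mem_filter.1 hy).2.symm) (l, m)
  · have hK : K.card = (n * q ^ 2 + 1) ^ (L * L) := by simp [K]
    have hP : P.card = C.card ^ L := by simp [P]
    rw [hK, hP] at hle
    calc _ ≤ (C.card * (2 ^ n * q ^ d)) ^ L := Nat.pow_le_pow_left hcard L
      _ = C.card ^ L * (2 ^ n * q ^ d) ^ L := mul_pow _ _ _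
      _ ≤ _ := Nat.mul_le_mul_right _ hle
  · rw [← Finset.card_pos]
    by_contra h0
    have h0 : (P.filter fun x => key x = k).card = 0 := by omega
    rw [h0, mul_zero] at hle
    exact absurd hle (not_le.2 (Finset.card_pos.2 hPne))

/-! ### Separation of superposed layers -/

/-- The superposition `∑ M^{-m} x_m / (L q)` of the components of a tuple. -/
def superpose {L n q : ℕ} (M : ℝ) (x : Fin L → Fin n → Fin q) (t : Fin n) : ℝ :=
  (∑ m : Fin L, (x m t : ℕ) / (M ^ (m : ℕ) * q)) / L

lemma superpose_mem_Icc {L n q : ℕ} (hL : 1 ≤ L) {M : ℝ} (hM : 1 ≤ M)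
    (x : Fin L → Fin n → Fin q) (t : Fin n) : superpose M x t ∈ Set.Icc (0 : ℝ) 1 := by
  have hL' : (0 : ℝ) < L := by exact_mod_cast hL
  have hterm : ∀ m : Fin L, (((x m t : ℕ) : ℝ)) / (M ^ (m : ℕ) * q) ≤ 1 := fun m => by
    have hlt : ((x m t : ℕ) : ℝ) < q := by exact_mod_cast (x m t).2
    have hq : (0 : ℝ) ≤ (x m t : ℕ) := Nat.cast_nonneg _
    refine div_le_one_of_le₀ (hlt.le.trans ?_) (by positivity)
    exact le_mul_of_one_le_left (by positivity) (one_le_pow₀ hM)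
  constructor
  · exact div_nonneg (Finset.sum_nonneg fun m _ => by positivity) hL'.le
  · refine div_le_one_of_le₀ ((Finset.sum_le_card_nsmul _ _ _ fun m _ => hterm m).trans ?_) hL'.le
    simp

/-- For integer words, the squared Euclidean distance dominates the Hamming distance. -/
lemma hammingDist_le_sum_sq {n q : ℕ} (x y : Fin n → Fin q) :
    (hammingDist x y : ℝ) ≤ ∑ t, (((y t : ℕ) : ℝ) - (x t : ℕ)) ^ 2 := by
  classical
  rw [hammingDist, Finset.card_filter]
  push_cast
  refine Finset.sum_le_sum fun t _ => ?_
  split_ifs with h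
  · have hz : ((y t : ℕ) : ℤ) - (x t : ℕ) ≠ 0 := fun h0 => h (Fin.ext (by omega))
    have : (1 : ℤ) ≤ (((y t : ℕ) : ℤ) - (x t : ℕ)) ^ 2 := by
      rw [← sq_abs]; exact one_le_pow₀ (Int.one_le_abs hz)
    exact_mod_cast this
  · positivity

/-- An integer is bounded in modulus by its square, so the bound is linear in the squared distance,
hence comparable with the main term -D/2. -/
lemma abs_sum_sub_mul_le {n q : ℕ} (x y z : Fin n → Fin q) :
    |∑ t, (((y t : ℕ) : ℝ) - (x t : ℕ)) * (z t : ℕ)| ≤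
      q * ∑ t, (((y t : ℕ) : ℝ) - (x t : ℕ)) ^ 2 := by
  rw [Finset.mul_sum]
  refine (Finset.abs_sum_le_sum_abs _ _).trans (Finset.sum_le_sum fun t _ => ?_)
  have h1 : |((y t : ℕ) : ℝ) - (x t : ℕ)| ≤ (((y t : ℕ) : ℝ) - (x t : ℕ)) ^ 2 := by
    have : |((y t : ℕ) : ℤ) - (x t : ℕ)| ≤ (((y t : ℕ) : ℤ) - (x t : ℕ)) ^ 2 := by
      rw [← sq_abs]; exact Int.le_self_sq _
    exact_mod_cast this
  have h2 : ((z t : ℕ) : ℝ) ≤ q := by exact_mod_cast (z t).2.le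
  rw [abs_mul, Nat.abs_cast, mul_comm]
  exact mul_le_mul h2 h1 (abs_nonneg _) (by positivity)

/-- Superpositions of distinct tuples are separated by the first component in which the
tuples differ. -/
lemma exists_separating_component {L n d q : ℕ} (hq : 1 ≤ q)
    {x y : Fin L → Fin n → Fin q} (hxy : x ≠ y)
    (hd : ∀ l, x l ≠ y l → d ≤ hammingDist (x l) (y l))
    (hip : ∀ l m, ∑ t, (x l t : ℕ) * (x m t : ℕ) = ∑ t, (y l t : ℕ) * (y m t : ℕ)) :
    ∃ l, d / (4 * L * (4 * L * q : ℝ) ^ L * q ^ 2) ≤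
      |∑ t, ((x l t : ℕ) : ℝ) / q * (superpose (4 * L * q) y t - superpose (4 * L * q) x t)| := by
  classical
  obtain ⟨l₀, hl₀⟩ := Function.ne_iff.1 hxy
  have hL : 1 ≤ L := Nat.one_le_of_lt l₀.2
  have hL' : (1 : ℝ) ≤ L := by exact_mod_cast hL
  have hq' : (1 : ℝ) ≤ q := by exact_mod_cast hq
  obtain ⟨l, hl, hmin⟩ : ∃ l, x l ≠ y l ∧ ∀ m < l, x m = y m := by
    obtain ⟨l, hl⟩ := (Set.toFinite {l | x l ≠ y l}).exists_minimal ⟨l₀, hl₀⟩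
    refine ⟨l, hl.prop, fun m hm => ?_⟩
    by_contra hne
    exact absurd (hl.le_of_le hne hm.le) (not_le.2 hm)
  refine ⟨l, ?_⟩
  set M : ℝ := 4 * L * q with hMdef
  have hM : 1 ≤ M := by nlinarith
  have hM0 : 0 < M := by linarith
  set D : ℝ := ∑ t, (((y l t : ℕ) : ℝ) - (x l t : ℕ)) ^ 2 with hD
  have hdD : (d : ℝ) ≤ D := by
    refine le_trans ?_ (hammingDist_le_sum_sq (x l) (y l))
    exact_mod_cast hd l hl
  have hD0 : 0 ≤ D := (Nat.cast_nonneg d).trans hdD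
  have hip' : ∀ l m, ∑ t, ((x l t : ℕ) : ℝ) * (x m t : ℕ) = ∑ t, ((y l t : ℕ) : ℝ) * (y m t : ℕ) :=
    fun l m => by exact_mod_cast hip l m
  let e : Fin L → ℝ := fun m => ∑ t, ((x l t : ℕ) : ℝ) * (((y m t : ℕ) : ℝ) - (x m t : ℕ))
  have he_cross : ∀ m, e m = -∑ t, (((y l t : ℕ) : ℝ) - (x l t : ℕ)) * (y m t : ℕ) := by
    intro m
    simp only [e, mul_sub, sub_mul, Finset.sum_sub_distrib]
    linarith [hip' l m]
  have he_diag : e l = -(D / 2) := by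
    have h1 : D = ∑ t, ((y l t : ℕ) : ℝ) * (y l t : ℕ) + ∑ t, ((x l t : ℕ) : ℝ) * (x l t : ℕ)
        - 2 * ∑ t, ((x l t : ℕ) : ℝ) * (y l t : ℕ) := by
      rw [hD, Finset.mul_sum, ← Finset.sum_add_distrib, ← Finset.sum_sub_distrib]
      exact Finset.sum_congr rfl fun t _ => by ring
    simp only [e, mul_sub, Finset.sum_sub_distrib]
    linarith [hip' l l]
  -- One factor `q` comes from the test weights, the other from the superposition.
  have hrep : ∑ t, ((x l t : ℕ) : ℝ) / q * (superpose M y t - superpose M x t) =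
      (∑ m : Fin L, e m / M ^ (m : ℕ)) / (L * q ^ 2) := by
    simp only [superpose, e, Finset.sum_div, ← Finset.sum_sub_distrib, Finset.mul_sum]
    rw [Finset.sum_comm]
    refine Finset.sum_congr rfl fun m _ => Finset.sum_congr rfl fun t _ => ?_
    field_simp
  have hsum : ∑ m : Fin L, e m / M ^ (m : ℕ) =
      -(D / 2) / M ^ (l : ℕ) + ∑ m ∈ Finset.univ.erase l, e m / M ^ (m : ℕ) := by
    rw [← he_diag]
    exact (Finset.add_sum_erase _ (fun m : Fin L => e m / M ^ (m : ℕ)) (Finset.mem_univ l)).symm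
  have hrest : |∑ m ∈ Finset.univ.erase l, e m / M ^ (m : ℕ)| ≤ D / 4 / M ^ (l : ℕ) := by
    have hterm : ∀ m ∈ Finset.univ.erase l,
        |e m / M ^ (m : ℕ)| ≤ D / (4 * L) / M ^ (l : ℕ) := by
      intro m hm
      rcases lt_or_gt_of_ne (Finset.ne_of_mem_erase hm) with h | h
      · have : e m = 0 := by simp [e, hmin m h]
        rw [this, zero_div, abs_zero]
        positivity
      · have h1 : |e m| ≤ q * D := by
          rw [he_cross, abs_neg]; exact abs_sum_sub_mul_le _ _ _
        rw [abs_div, abs_of_pos (pow_pos hM0 _)]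
        -- One extra factor M = 4Lq absorbs `q` and leaves 1/(4L), so at most `L` such terms take
        -- half of the main term.
        calc |e m| / M ^ (m : ℕ) ≤ q * D / M ^ ((l : ℕ) + 1) := by
              have hlm : (l : ℕ) + 1 ≤ m := h
              gcongr
          _ = D / (4 * L) / M ^ (l : ℕ) := by
              rw [pow_succ]
              nth_rewrite 2 [hMdef]
              field_simp
    refine (Finset.abs_sum_le_sum_abs _ _).trans
      ((Finset.sum_le_card_nsmul _ _ _ hterm).trans ?_)
    have hc : ((Finset.univ.erase l).card : ℝ) ≤ L := by
      have := Finset.card_le_univ (Finset.univ.erase l)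
      rw [Fintype.card_fin] at this
      exact_mod_cast this
    rw [nsmul_eq_mul]
    calc _ ≤ L * (D / (4 * L) / M ^ (l : ℕ)) := mul_le_mul_of_nonneg_right hc (by positivity)
      _ = _ := by field_simp
  have hbound : D / 4 / M ^ (l : ℕ) ≤ |∑ m : Fin L, e m / M ^ (m : ℕ)| := by
    rw [hsum]
    have h1 := (abs_le.1 hrest).2
    have h2 : -(D / 2) / M ^ (l : ℕ) = -2 * (D / 4 / M ^ (l : ℕ)) := by ring
    rw [h2]
    refine le_trans ?_ (neg_le_abs _)
    linarith
  rw [hrep, abs_div, abs_of_pos (by positivity : (0 : ℝ) < L * q ^ 2)]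
  calc (d : ℝ) / (4 * L * M ^ L * q ^ 2) ≤ D / (4 * L * M ^ (l : ℕ) * q ^ 2) := by
        have : (l : ℕ) ≤ L := l.2.le
        gcongr
    _ = D / 4 / M ^ (l : ℕ) / (L * q ^ 2) := by field_simp
    _ ≤ _ := by gcongr

/-! ### Choice of parameters and the exact rate -/

/-- The affine map from the unit interval onto `[a, b]`. -/
def rescale (a b : unitInterval) (hab : a < b) (z : ℝ) (hz : z ∈ Set.Icc (0 : ℝ) 1) :
    Set.Icc a b :=
  have hab' : (a : ℝ) < b := hab
  have h1 : (a : ℝ) ≤ a + (b - a) * z := by nlinarith [hz.1]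
  have h2 : (a : ℝ) + (b - a) * z ≤ b := by nlinarith [hz.2]
  ⟨⟨a + (b - a) * z, a.2.1.trans h1, h2.trans b.2.2⟩, h1, h2⟩

lemma coe_rescale (a b : unitInterval) (hab : a < b) (z : ℝ) (hz : z ∈ Set.Icc (0 : ℝ) 1) :
    ((rescale a b hab z hz : unitInterval) : ℝ) = a + (b - a) * z := rfl

/-- Existence of DI codes at a given block length, in terms of the free parameters of the
construction. -/
lemma exists_diCode (a b : unitInterval) (hab : a < b) {L n d q : ℕ} (hL : 1 ≤ L) (hq : 1 ≤ q)
    {τ lam : ℝ} (hτ : 0 ≤ τ)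
    (hsep : 2 * τ ≤ ((b : ℝ) - a) * (d / (4 * L * (4 * L * q : ℝ) ^ L * q ^ 2)))
    (hlam : L * (2 * Real.exp (-2 * τ ^ 2 / n)) ≤ lam) :
    ∃ K : ℕ, 0 < K ∧ (q ^ n) ^ L ≤ (n * q ^ 2 + 1) ^ (L * L) * K * (2 ^ n * q ^ d) ^ L ∧
      ∀ N ≤ K, Nonempty (DICode (restrictInput bernoulliChannel (Set.Icc a b)) n N lam lam) := by
  obtain ⟨T, hd, hip, hcard, hne⟩ := exists_equiangular_tuples L n d hq
  have hab' : (0 : ℝ) < b - a := sub_pos.2 hab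
  have hL' : (1 : ℝ) ≤ L := by exact_mod_cast hL
  have hq' : (1 : ℝ) ≤ q := by exact_mod_cast hq
  have hM : (1 : ℝ) ≤ 4 * L * q := by nlinarith
  have hexp : 2 * Real.exp (-2 * τ ^ 2 / n) ≤ lam :=
    (le_mul_of_one_le_left (by positivity) hL').trans hlam
  refine ⟨T.card, hne.card_pos, hcard, fun N hN => ?_⟩
  refine nonempty_diCode_of_separated (ι := T) (L := L) (τ := τ) (by simpa using hN)
    (fun x t => rescale a b hab _ (superpose_mem_Icc hL hM x.1 t))
    (fun x l t => ((x.1 l t : ℕ) : ℝ) / q) ?_ hτ ?_ hlam hexp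
    (lt_of_lt_of_le (by positivity) hexp)
  · intro x l t
    rw [abs_of_nonneg (by positivity)]
    refine div_le_one_of_le₀ ?_ (by positivity)
    exact_mod_cast (x.1 l t).2.le
  · intro x y hxy
    obtain ⟨l, hl⟩ := exists_separating_component hq (fun h => hxy (Subtype.ext h))
      (hd x.1 x.2 y.1 y.2) (hip x.1 x.2 y.1 y.2)
    refine ⟨l, hsep.trans ?_⟩
    have : ∑ t, ((x.1 l t : ℕ) : ℝ) / q *
        (((rescale a b hab _ (superpose_mem_Icc hL hM y.1 t) : unitInterval) : ℝ) -
          (rescale a b hab _ (superpose_mem_Icc hL hM x.1 t) : unitInterval)) =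
        ((b : ℝ) - a) * ∑ t, ((x.1 l t : ℕ) : ℝ) / q *
          (superpose (4 * L * q) y.1 t - superpose (4 * L * q) x.1 t) := by
      rw [Finset.mul_sum]
      refine Finset.sum_congr rfl fun t _ => ?_
      rw [coe_rescale, coe_rescale]
      ring
    rw [this, abs_mul, abs_of_pos hab']
    gcongr

lemma tendsto_log_natCast : Tendsto (fun n : ℕ => Real.log n) atTop atTop :=
  Real.tendsto_log_atTop.comp tendsto_natCast_atTop_atTop

lemma eventually_log_le_rpow (C : ℝ) {γ : ℝ} (hγ : 0 < γ) :
    ∀ᶠ n : ℕ in atTop, C * Real.log n ≤ (n : ℝ) ^ γ := by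
  have h := ((isLittleO_log_rpow_atTop hγ).const_mul_left C).bound (by norm_num : (0 : ℝ) < 1)
  filter_upwards [tendsto_natCast_atTop_atTop.eventually h] with n hn
  rw [one_mul, Real.norm_of_nonneg (by positivity : (0 : ℝ) ≤ (n : ℝ) ^ γ)] at hn
  exact (le_abs_self _).trans hn

/-- DI codes with error bounds `errorBound n` exist at every linearithmic rate below `1 / 2`. -/
lemma eventually_nonempty_diCode (a b : unitInterval) (hab : a < b) {r : ℝ} (hr : r < 1 / 2) :
    ∀ᶠ n : ℕ in atTop, Nonempty (DICode (restrictInput bernoulliChannel (Set.Icc a b)) n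
      ⌊Real.exp (r * (n * Real.log n))⌋₊ (errorBound n) (errorBound n)) := by
  -- The number of layers depends only on `r`; the right side is 1/2 - 2/(L+3).
  obtain ⟨L, hL, hLr⟩ : ∃ L : ℕ, 1 ≤ L ∧ r < (L - 1) / (2 * (L + 3)) := by
    obtain ⟨L, hL⟩ := exists_nat_gt (2 / (1 / 2 - r))
    refine ⟨L + 1, by omega, ?_⟩
    have h0 : 0 < 1 / 2 - r := by linarith
    rw [div_lt_iff₀ h0] at hL
    have hL0 : (0 : ℝ) ≤ L := Nat.cast_nonneg L
    push_cast
    rw [lt_div_iff₀ (by positivity)]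
    nlinarith
  have hL1 : (1 : ℝ) ≤ L := by exact_mod_cast hL
  -- Separation costs q^(L+2) and must stay below √n with a spare n^γ to beat log n; hence (L+3)γ =
  -- 1/2.
  set γ : ℝ := 1 / (2 * (L + 3)) with hγdef
  have hγ : 0 < γ := by positivity
  have hγ1 : γ ≤ 1 := by
    rw [hγdef, div_le_one (by positivity)]; linarith
  have hab' : (0 : ℝ) < b - a := sub_pos.2 hab
  set A : ℝ := 4 * L * (4 * L) ^ L with hA
  have hA0 : 0 < A := by positivity
  -- Losses relative to n log n: the 2^n in the Hamming balls and the rounding of `q`, then the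
  -- pigeonhole classes.
  have hlim : Tendsto (fun n : ℕ => 2 * L * Real.log 2 / Real.log n + 4 * L ^ 2 / n) atTop
      (𝓝 0) := by
    simpa using (tendsto_log_natCast.const_div_atTop (2 * L * Real.log 2)).add
      (tendsto_natCast_atTop_atTop.const_div_atTop ((4 : ℝ) * L ^ 2))
  have hgap : 0 < (L - 1) * γ - r := by
    rw [hγdef, mul_one_div]; linarith
  filter_upwards [eventually_ge_atTop (2 * L), eventually_ge_atTop 3,
    hlim.eventually (gt_mem_nhds hgap), eventually_log_le_rpow (8 * A * L / ((b : ℝ) - a)) hγ,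
    tendsto_log_natCast.eventually_ge_atTop 1] with n hnL hn3 hcount hlogn hlog1
  have hn : (3 : ℝ) ≤ n := by exact_mod_cast hn3
  have hn0 : (0 : ℝ) < n := by linarith
  have hx1 : 1 ≤ (n : ℝ) ^ γ := Real.one_le_rpow (by linarith) hγ.le
  set q : ℕ := ⌊(n : ℝ) ^ γ⌋₊ with hqdef
  have hq : 1 ≤ q := (Nat.one_le_floor_iff _).2 hx1
  have hq1 : (1 : ℝ) ≤ q := by exact_mod_cast hq
  have hqle : (q : ℝ) ≤ (n : ℝ) ^ γ := Nat.floor_le (by positivity)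
  have hqge : (n : ℝ) ^ γ / 2 ≤ q := by
    have := Nat.lt_floor_add_one ((n : ℝ) ^ γ)
    rw [← hqdef] at this
    linarith
  have hdle : ((n / L : ℕ) : ℝ) * L ≤ n := by exact_mod_cast Nat.div_mul_le_self n L
  have hdge : (n : ℝ) / (2 * L) ≤ (n / L : ℕ) := by
    have h1 : (n : ℝ) < ((n / L : ℕ) + 1) * L := by
      exact_mod_cast Nat.lt_mul_of_div_lt (Nat.lt_succ_self (n / L)) hL
    have h2 : (2 : ℝ) * L ≤ n := by exact_mod_cast hnL
    rw [div_le_iff₀ (by positivity)]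
    nlinarith
  have hsep : 2 * (2 * √n * Real.log n) ≤ ((b : ℝ) - a) *
      ((n / L : ℕ) / (4 * L * (4 * L * q : ℝ) ^ L * q ^ 2)) := by
    have hqpow : (q : ℝ) ^ (L + 2) * (n : ℝ) ^ γ ≤ √n := by
      calc _ ≤ ((n : ℝ) ^ γ) ^ (L + 2) * (n : ℝ) ^ γ := by gcongr
        _ = √n := by
          rw [← pow_succ, ← Real.rpow_mul_natCast hn0.le, Real.sqrt_eq_rpow, hγdef]
          congr 1
          push_cast
          field_simp
          ring
    have hden : 4 * L * (4 * L * q : ℝ) ^ L * q ^ 2 = A * q ^ (L + 2) := by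
      rw [hA, mul_pow, pow_add]; ring
    rw [hden, ← mul_div_assoc, le_div_iff₀ (by positivity)]
    have h1 : 8 * A * L * Real.log n ≤ (b - a) * (n : ℝ) ^ γ := by
      rw [div_mul_eq_mul_div, div_le_iff₀ hab'] at hlogn
      linarith
    calc 2 * (2 * √n * Real.log n) * (A * q ^ (L + 2))
        = (8 * A * L * Real.log n) * (√n * q ^ (L + 2)) / (2 * L) := by field_simp; ring
      _ ≤ ((b - a) * (n : ℝ) ^ γ) * (√n * q ^ (L + 2)) / (2 * L) := by gcongr
      _ = (b - a) * (√n * (q ^ (L + 2) * (n : ℝ) ^ γ)) / (2 * L) := by ring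
      _ ≤ (b - a) * (√n * √n) / (2 * L) := by gcongr
      _ = (b - a) * (n / (2 * L)) := by rw [Real.mul_self_sqrt hn0.le]; ring
      _ ≤ _ := by gcongr
  -- The exponent is -8 (log n)²: two parts give the error bound, the other six absorb L ≤ n.
  have hlam : L * (2 * Real.exp (-2 * (2 * √n * Real.log n) ^ 2 / n)) ≤ errorBound n := by
    have h1 : -2 * (2 * √n * Real.log n) ^ 2 / n = -6 * Real.log n ^ 2 + -2 * Real.log n ^ 2 := by
      rw [mul_pow, mul_pow, Real.sq_sqrt hn0.le]
      field_simp
      norm_num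
    have h2 : L * Real.exp (-6 * Real.log n ^ 2) ≤ 1 := by
      have h3 : (L : ℝ) ≤ Real.exp (6 * Real.log n ^ 2) := by
        have h4 : (L : ℝ) ≤ n := by
          have : L ≤ n := by omega
          exact_mod_cast this
        refine h4.trans ?_
        rw [← Real.exp_log hn0, Real.log_exp, Real.exp_le_exp]
        nlinarith
      rw [neg_mul, Real.exp_neg, ← div_eq_mul_inv]
      exact div_le_one_of_le₀ h3 (Real.exp_pos _).le
    rw [h1, Real.exp_add, errorBound]
    have := mul_le_mul_of_nonneg_right h2 (Real.exp_pos (-2 * Real.log n ^ 2)).le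
    linarith
  obtain ⟨K, hK, hcard, hcode⟩ := exists_diCode a b hab hL hq (by positivity) hsep hlam
  refine hcode _ (Nat.floor_le_of_le ?_)
  have hK0 : (0 : ℝ) < K := by exact_mod_cast hK
  rw [← Real.le_log_iff_exp_le hK0]
  have hq0 : (q : ℝ) ≠ 0 := by positivity
  have hlogcard : L * (n * Real.log q) ≤ L * L * Real.log (n * q ^ 2 + 1) + Real.log K +
      L * (n * Real.log 2 + (n / L : ℕ) * Real.log q) := by
    have hcast : (((q : ℝ) ^ n) ^ L) ≤
        ((n : ℝ) * q ^ 2 + 1) ^ (L * L) * K * (2 ^ n * q ^ (n / L)) ^ L := by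
      exact_mod_cast hcard
    have h1 := Real.log_le_log (by positivity) hcast
    rw [Real.log_mul (by positivity) (by positivity), Real.log_mul (by positivity) (by positivity),
      Real.log_pow, Real.log_pow, Real.log_pow, Real.log_pow,
      Real.log_mul (by positivity) (by positivity), Real.log_pow, Real.log_pow] at h1
    push_cast at h1
    exact h1
  have hlogq : γ * Real.log n - Real.log 2 ≤ Real.log q := by
    rw [← Real.log_rpow hn0, ← Real.log_div (by positivity) (by norm_num)]
    exact Real.log_le_log (by positivity) hqge
  have hlogq0 : 0 ≤ Real.log q := Real.log_nonneg hq1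
  have hlogkey : Real.log (n * q ^ 2 + 1) ≤ 4 * Real.log n := by
    have hqn : (q : ℝ) ≤ n := hqle.trans
      ((Real.rpow_le_rpow_of_exponent_le (by linarith) hγ1).trans (Real.rpow_one _).le)
    have h4 : 4 * Real.log n = Real.log ((n : ℝ) ^ 4) := by
      rw [Real.log_pow]; norm_num
    rw [h4]
    refine Real.log_le_log (by positivity) ?_
    have h5 : (n : ℝ) * q ^ 2 ≤ n * n ^ 2 := by gcongr
    have h6 : (1 : ℝ) ≤ n ^ 3 := one_le_pow₀ (by linarith)
    nlinarith
  have hlog0 : 0 < Real.log n := by linarith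
  have hmain : r * (n * Real.log n) + (2 * L * n * Real.log 2 + 4 * L ^ 2 * Real.log n) ≤
      (L - 1) * γ * (n * Real.log n) := by
    have h1 := mul_le_mul_of_nonneg_right hcount.le (mul_pos hn0 hlog0).le
    have h2 : (2 * L * Real.log 2 / Real.log n + 4 * L ^ 2 / n) * (n * Real.log n) =
        2 * L * n * Real.log 2 + 4 * L ^ 2 * Real.log n := by
      field_simp
    rw [h2] at h1
    linarith
  have h1 : (L : ℝ) * ((n / L : ℕ) * Real.log q) ≤ n * Real.log q := by
    have := mul_le_mul_of_nonneg_right hdle hlogq0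
    linarith
  have h2 : (L - 1) * n * (γ * Real.log n - Real.log 2) ≤ (L - 1) * n * Real.log q :=
    mul_le_mul_of_nonneg_left hlogq (mul_nonneg (by linarith) hn0.le)
  have h3 : (L : ℝ) * L * Real.log (n * q ^ 2 + 1) ≤ L * L * (4 * Real.log n) := by gcongr
  have h4 : 0 ≤ n * Real.log 2 := mul_nonneg hn0.le (Real.log_nonneg (by norm_num))
  linarith

/-- A DI code may be shortened and its error bounds relaxed. -/
lemma nonempty_diCode_mono {X Y : Type*} [MeasurableSpace X] [MeasurableSpace Y]
    {W : Kernel X Y} [IsMarkovKernel W] {n N N' : ℕ} {lam₁ lam₂ lam₁' : ℝ}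
    (h : Nonempty (DICode W n N lam₁ lam₂)) (hN : N' ≤ N) (hlam : lam₁ ≤ lam₁') :
    Nonempty (DICode W n N' lam₁' lam₂) := by
  obtain ⟨C⟩ := h
  exact ⟨⟨fun i => C.word (Fin.castLE hN i), fun i => C.region (Fin.castLE hN i),
    fun i => C.measurableSet_region _, C.pos₁.trans_le hlam, C.pos₂,
    fun i => (by linarith : 1 - lam₁' ≤ 1 - lam₁).trans (C.missed_le _),
    fun i j hij => C.false_le _ _ fun h => hij (Fin.castLE_injective hN h)⟩⟩

lemma errorBound_pos (n : ℕ) : 0 < errorBound n := by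
  unfold errorBound; positivity

lemma tendsto_errorBound : Tendsto errorBound atTop (𝓝 0) := by
  have h : Tendsto (fun n : ℕ => -2 * Real.log n ^ 2) atTop atBot :=
    ((tendsto_pow_atTop two_ne_zero).comp tendsto_log_natCast).const_mul_atTop_of_neg (by norm_num)
  have h2 := (Real.tendsto_exp_atBot.comp h).const_mul 2
  rw [mul_zero] at h2
  exact h2

/-- The largest size, at most `exp ((n log n) / 2)`, of a DI code with error bounds
`errorBound n`. -/
def codeSize (a b : unitInterval) (n : ℕ) : ℕ := by
  classical
  exact Nat.findGreatest (fun N => Nonempty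
    (DICode (restrictInput bernoulliChannel (Set.Icc a b)) n N (errorBound n) (errorBound n)))
    ⌊Real.exp (1 / 2 * (n * Real.log n))⌋₊

lemma nonempty_diCode_codeSize (a b : unitInterval) (n : ℕ) :
    Nonempty (DICode (restrictInput bernoulliChannel (Set.Icc a b)) n (codeSize a b n)
      (errorBound n) (errorBound n)) := by
  classical
  refine Nat.findGreatest_spec (P := fun N => Nonempty
    (DICode (restrictInput bernoulliChannel (Set.Icc a b)) n N (errorBound n) (errorBound n)))
    (Nat.zero_le _) ?_
  -- The empty code, so every block length has a code.
  exact ⟨⟨Fin.elim0, Fin.elim0, fun i => i.elim0, errorBound_pos n, errorBound_pos n,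
    fun i => i.elim0, fun i => i.elim0⟩⟩

/-- The cap in `codeSize` gives the upper bound, and maximality beats every rate below 1/2, so one
sequence attains the limit itself. -/
lemma tendsto_rate_codeSize (a b : unitInterval) (hab : a < b) :
    Tendsto (fun n : ℕ => Real.log (codeSize a b n) / (n * Real.log n)) atTop (𝓝 (1 / 2)) := by
  classical
  have hnlog : Tendsto (fun n : ℕ => (n : ℝ) * Real.log n) atTop atTop :=
    tendsto_natCast_atTop_atTop.atTop_mul_atTop₀ tendsto_log_natCast
  refine tendsto_order.2 ⟨fun r hr => ?_, fun r hr => ?_⟩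
  -- Taking s > 0 makes the exponential at least 1, so the floor loses at most a factor 2; s > r
  -- pays for it.
  · obtain ⟨s, hs1, hs2⟩ := exists_between (max_lt hr (by norm_num : (0 : ℝ) < 1 / 2))
    obtain ⟨hrs, hs0⟩ := max_lt_iff.1 hs1
    have hlim := (hnlog.const_div_atTop (Real.log 2)).eventually (gt_mem_nhds (sub_pos.2 hrs))
    filter_upwards [eventually_nonempty_diCode a b hab hs2, hlim,
      hnlog.eventually_gt_atTop 0] with n hcode hlog2 hpos
    have hle : ⌊Real.exp (s * (n * Real.log n))⌋₊ ≤ codeSize a b n :=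
      Nat.le_findGreatest (Nat.floor_le_floor (Real.exp_le_exp.2
        (mul_le_mul_of_nonneg_right hs2.le hpos.le))) hcode
    have hexp1 : 1 ≤ Real.exp (s * (n * Real.log n)) := Real.one_le_exp (by positivity)
    have hhalf : Real.exp (s * (n * Real.log n)) / 2 ≤ codeSize a b n := by
      have h1 := Nat.lt_floor_add_one (Real.exp (s * (n * Real.log n)))
      have h2 : (1 : ℝ) ≤ ⌊Real.exp (s * (n * Real.log n))⌋₊ := by
        exact_mod_cast (Nat.one_le_floor_iff _).2 hexp1
      have h3 : ((⌊Real.exp (s * (n * Real.log n))⌋₊ : ℕ) : ℝ) ≤ codeSize a b n := by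
        exact_mod_cast hle
      linarith
    have hlog := Real.log_le_log (by positivity) hhalf
    rw [Real.log_div (Real.exp_ne_zero _) (by norm_num), Real.log_exp] at hlog
    rw [div_lt_iff₀ hpos] at hlog2
    rw [lt_div_iff₀ hpos]
    linarith
  · filter_upwards [hnlog.eventually_gt_atTop 0] with n hpos
    refine lt_of_le_of_lt ?_ hr
    rw [div_le_iff₀ hpos]
    rcases Nat.eq_zero_or_pos (codeSize a b n) with h0 | h0
    · rw [h0, Nat.cast_zero, Real.log_zero]; positivity
    · rw [Real.log_le_iff_le_exp (by exact_mod_cast h0)]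
      have h1 : codeSize a b n ≤ ⌊Real.exp (1 / 2 * (n * Real.log n))⌋₊ := Nat.findGreatest_le _
      exact (Nat.cast_le.2 h1).trans (Nat.floor_le (Real.exp_pos _).le)

lemma codesAchieveRate_codeSize (a b : unitInterval) (hab : a < b) {L : ℕ} (hL : 1 ≤ L) :
    CodesAchieveRate (restrictInput bernoulliChannel (Set.Icc a b)) (codeSize a b)
      (fun n => L * errorBound n) errorBound (1 / 2) := by
  refine ⟨fun n => nonempty_diCode_mono (nonempty_diCode_codeSize a b n) le_rfl ?_, ?_,
    tendsto_errorBound, tendsto_rate_codeSize a b hab⟩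
  · exact le_mul_of_one_le_left (errorBound_pos n).le (by exact_mod_cast hL)
  · simpa using tendsto_errorBound.const_mul (L : ℝ)

end DetId

end

theorem mainTheorem4 (a b : unitInterval) (hab : a < b) :
    (∀ L : ℕ, 1 ≤ L → ∃ N : ℕ → ℕ,
      DetId.CodesAchieveRate (DetId.restrictInput DetId.bernoulliChannel (Set.Icc a b)) N
        (fun n => L * DetId.errorBound n) DetId.errorBound (1 / 2)) ∧
    DetId.IsLinearithmicDICapacity
      (DetId.restrictInput DetId.bernoulliChannel (Set.Icc a b)) (1 / 2) :=
  ⟨fun _ hL => ⟨_, DetId.codesAchieveRate_codeSize a b hab hL⟩,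
    ⟨by norm_num, _, _, _, DetId.codesAchieveRate_codeSize a b hab le_rfl⟩,
    fun _ ⟨_, _, _, _, h⟩ => DetId.rate_le_half h⟩
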